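/- For $\delta\in\mathbb R$, $\mu\in\mathbb R$, $\sigma>0$, let $Y_1,Y_2,\dots$ be i.i.d. $N(\mu,\sigma^2)$ with effect size $\mu/\sigma=\delta$, let $U_i=Y_i/|Y_1|$ be the (scale-)maximal invariants, and write $U^n=(U_1,\dots,U_n)$. The law of $(U_1,U_2,\dots)$ depends on $(\mu,\sigma)$ only through $\delta=\mu/\sigma$; let $P_\delta^{U^n}$ denote the resulting law of $U^n$. For each $n\ge 0$ the laws $P_\delta^{U^n}$, $\delta\in\mathbb R$, are mutually absolutely continuous. Let $\delta_0<\delta^+$ be real numbers and let $p_{\delta^+}(u^n)=\frac{dP_{\delta^+}^{U^n}}{dP_{\delta_0}^{U^n}}(u^n)$ be the likelihood ratio relative to $\delta_0$. Then the scale-invariant t-test likelihood ratio process $(p_{\delta^+}(U^n))_{n\ge 0}$ is a test supermartingale for the one-sided null $\mathcal H_{\delta\le\delta_0}$ in the filtration $(\sigma(U^n))_{n\ge 0}$. That is, it is non-negative, equals $1$ at $n=0$, and is a supermartingale with respect to $(\sigma(U^n))_{n\ge 0}$ under every probability measure under which $Y_1,Y_2,\dots$ are i.i.d. $N(\mu,\sigma^2)$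 for some $\mu\in\mathbb R$, $\sigma>0$ with $\mu/\sigma\le\delta_0$. -/

import Mathlib

open MeasureTheory ProbabilityTheory
open scoped NNReal ENNReal

noncomputable section

namespace TTest

/-- The maximal invariants of a data sequence under rescaling: `U_i = Y_i / |Y_1|`.
Sequences are indexed from `0`, so that `y 0` is the first observation. -/
def maximalInvariant (y : ℕ → ℝ) (i : ℕ) : ℝ := y i / |y 0|

/-- The first `n` maximal invariants, `U^n = (U_1, …, U_n)`; for `n = 0` the empty tuple. -/
def invariantVec (n : ℕ) (y : ℕ → ℝ) : Fin n → ℝ := fun i => maximalInvariant y i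

lemma measurable_invariantVec (n : ℕ) : Measurable (invariantVec n) := by
  unfold invariantVec maximalInvariant
  fun_prop

/-- Under `P`, the data `Y_1, Y_2, …` are i.i.d. normal with mean `μ` and standard deviation `σ`
(Mathlib's `gaussianReal` takes the variance). -/
structure IsIIDNormal {Ω : Type*} [MeasurableSpace Ω] (Y : ℕ → Ω → ℝ) (μ : ℝ) (σ : ℝ≥0)
    (P : Measure Ω) : Prop where
  indep : iIndepFun Y P
  law : ∀ i, P.map (Y i) = gaussianReal μ (σ ^ 2)

/-- The one-sided null hypothesis: all probability measures under which the data are i.i.d. normal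
with some mean `μ` and standard deviation `σ > 0` of effect size `μ / σ ≤ δ₀`. -/
def oneSidedNull {Ω : Type*} [MeasurableSpace Ω] (Y : ℕ → Ω → ℝ) (δ₀ : ℝ) : Set (Measure Ω) :=
  {P | IsProbabilityMeasure P ∧
    ∃ (μ : ℝ) (σ : ℝ≥0), 0 < σ ∧ μ / (σ : ℝ) ≤ δ₀ ∧ IsIIDNormal Y μ σ P}

/-- The law of the whole sequence `(U_1, U_2, …)` of maximal invariants at effect size `δ`,
obtained from i.i.d. `N(δ, 1)` data. -/
def invariantLaw (δ : ℝ) : Measure (ℕ → ℝ) :=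
  (Measure.infinitePi fun _ : ℕ => gaussianReal δ 1).map maximalInvariant

/-- The law of `U^n` at effect size `δ`. -/
def invariantVecLaw (δ : ℝ) (n : ℕ) : Measure (Fin n → ℝ) :=
  (invariantLaw δ).map fun u i => u i

/-- The density of the law of `U^n` at effect size `δ₁` relative to its law at `δ₀`. -/
def likelihoodRatio (δ₀ δ₁ : ℝ) (n : ℕ) (u : Fin n → ℝ) : ℝ :=
  ((invariantVecLaw δ₁ n).rnDeriv (invariantVecLaw δ₀ n) u).toReal

/-- The scale-invariant t-test likelihood ratio process: the density evaluated at `U^n`. -/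
def likelihoodRatioProcess {Ω : Type*} (Y : ℕ → Ω → ℝ) (δ₀ δ₁ : ℝ) (n : ℕ) (ω : Ω) : ℝ :=
  likelihoodRatio δ₀ δ₁ n (invariantVec n fun i => Y i ω)

/-- The filtration `(σ(U^n))_n`, starting with the trivial σ-algebra at `n = 0`. -/
def invariantFiltration {Ω : Type*} [m : MeasurableSpace Ω] (Y : ℕ → Ω → ℝ)
    (hY : ∀ i, Measurable (Y i)) : Filtration ℕ m where
  seq n := MeasurableSpace.comap (fun ω => invariantVec n fun i => Y i ω) inferInstance
  mono' := by
    intro a b hab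
    have h : (fun ω => invariantVec a fun i => Y i ω) =
        (fun (v : Fin b → ℝ) (i : Fin a) => v (Fin.castLE hab i)) ∘
          (fun ω => invariantVec b fun i => Y i ω) := rfl
    change MeasurableSpace.comap _ _ ≤ MeasurableSpace.comap _ _
    rw [h, ← MeasurableSpace.comap_comp]
    refine MeasurableSpace.comap_mono (Measurable.comap_le ?_)
    fun_prop
  le' n := ((measurable_invariantVec n).comp (measurable_pi_lambda _ hY)).comap_le

/-- A test supermartingale for the null hypothesis `H` in the filtration `F`: non-negative, started
at `1`, and a supermartingale under every measure in `H`. -/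
structure IsTestSupermartingale {Ω : Type*} [m : MeasurableSpace Ω] (M : ℕ → Ω → ℝ)
    (F : Filtration ℕ m) (H : Set (Measure Ω)) : Prop where
  nonneg : ∀ n ω, 0 ≤ M n ω
  initial : ∀ ω, M 0 ω = 1
  supermartingale : ∀ P ∈ H, Supermartingale M F P

end TTest

end

/-!
For `n ≥ 1` the law of `U^n` has a density `q_δ` with respect to counting measure on `{1, -1}` times
Lebesgue measure (`invariantVecLaw_eq_withDensity`): integrate the normal density of
`(s U_1, …, s U_n)` over the scale `s = |Y_1|`. After rescaling `s`, this density involves the effect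
size and the data jointly only through `h (δ T)`, where `h z = ∫₀^∞ rⁿ⁻¹ exp (-r² / 2 + r z) dr` and
`T` is the sum of the data divided by their Euclidean norm (`invariantDensity_eq_gaussMoment`).

The kernel `(δ, T) ↦ h (δ T)` is totally positive of order two (`gaussMoment_tp`). For `T` and `T'`
of opposite signs this is the monotonicity of `h`; for equal signs, the substitution `v = r T` makes
`h (δ T)` a mixture of the functions `exp (δ v)` by a totally positive mixing density. Hence, for
`δ ≤ δ₀ ≤ δ₁`, the ratio `q_{δ₁} / q_{δ₀}` is nondecreasing and `q_δ / q_{δ₀}` is nonincreasing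
in `T`.

Condition on `U^n`. The value of `T` after `n + 1` observations is not a monotone function of
`U_{n+1}`, but this does not matter: the two ratios are monotone in opposite directions in the same
function of `U_{n+1}`, so Chebyshev's association inequality under `δ₀`
(`lintegral_mul_lintegral_le_of_symm`) bounds the conditional expectation of
`q_{δ₁} / q_{δ₀}` under `δ` by its current value (`lintegral_likelihoodRatio_snoc_le`). The
consistency of the densities, `lintegral_invariantDensity_snoc`, identifies the integrals over the
new coordinate. With this, the expectations are at most one, which gives integrability, and the
inequality integrated over the events of `σ(U^n)` is the supermartingale property.
-/

namespace TTest
open Set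

/-! ### Correlation inequalities -/

/-- A four-function form of Chebyshev's association inequality: an inequality between the
symmetrised products `a ⊗ d` and `b ⊗ c` passes to the products of the integrals. -/
theorem lintegral_mul_lintegral_le_of_symm {α : Type*} [MeasurableSpace α] {ν : Measure α}
    [SFinite ν] {a b c d : α → ℝ≥0∞} (ha : Measurable a) (hb : Measurable b) (hc : Measurable c)
    (hd : Measurable d)
    (h : ∀ᵐ x ∂ν, ∀ᵐ y ∂ν, a x * d y + a y * d x ≤ b x * c y + b y * c x) :
    (∫⁻ x, a x ∂ν) * ∫⁻ x, d x ∂ν ≤ (∫⁻ x, b x ∂ν) * ∫⁻ x, c x ∂ν := by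
  have key : ∀ f g : α → ℝ≥0∞, Measurable f → Measurable g →
      ∫⁻ x, ∫⁻ y, (f x * g y + f y * g x) ∂ν ∂ν = 2 * ((∫⁻ x, f x ∂ν) * ∫⁻ x, g x ∂ν) := by
    intro f g hf hg
    have : ∀ x, ∫⁻ y, (f x * g y + f y * g x) ∂ν
        = f x * (∫⁻ y, g y ∂ν) + (∫⁻ y, f y ∂ν) * g x := fun x => by
      rw [lintegral_add_left (by fun_prop), lintegral_const_mul _ hg, lintegral_mul_const _ hf]
    simp_rw [this]
    rw [lintegral_add_left (by fun_prop), lintegral_mul_const _ hf, lintegral_const_mul _ hg]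
    ring
  have h2 := lintegral_mono_ae (h.mono fun x hx => lintegral_mono_ae hx)
  rw [key a d ha hd, key b c hb hc] at h2
  exact (ENNReal.mul_le_mul_iff_right (by simp) (by simp)).1 h2

/-! ### Scaling of integrals over the half-line -/

theorem lintegral_Ioi_comp_mul_left {c : ℝ} (hc : 0 < c) {f : ℝ → ℝ≥0∞} (hf : Measurable f) :
    ∫⁻ s in Ioi 0, f s = ENNReal.ofReal c * ∫⁻ r in Ioi 0, f (c * r) := by
  conv_lhs => rw [← Real.smul_map_volume_mul_left hc.ne']
  rw [Measure.restrict_smul, lintegral_smul_measure, abs_of_pos hc, smul_eq_mul,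
    setLIntegral_map measurableSet_Ioi hf (by fun_prop)]
  congr 3
  ext r
  simp [hc]

/-! ### Total positivity of the Gaussian moment integral -/

/-- The integral `∫₀^∞ rᵐ exp (-r² / 2 + r z) dr`. Up to factors that do not involve both the
effect size `δ` and the data, the density of the maximal invariants is its value at `δ T`, with
`T` the normalised sum of the data. -/
noncomputable def gaussMoment (m : ℕ) (z : ℝ) : ℝ≥0∞ :=
  ∫⁻ r in Ioi 0, ENNReal.ofReal (r ^ m * Real.exp (-r ^ 2 / 2 + r * z))

theorem gaussMoment_mono (m : ℕ) : Monotone (gaussMoment m) := by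
  intro z z' h
  refine setLIntegral_mono' measurableSet_Ioi fun r hr => ENNReal.ofReal_le_ofReal ?_
  have hr : 0 < r := hr
  gcongr

theorem gaussMoment_ne_top (m : ℕ) (z : ℝ) : gaussMoment m z ≠ ∞ := by
  have h := integrableOn_rpow_mul_exp_neg_mul_sq (b := 1 / 4) (by norm_num)
    (s := m) (by linarith [m.cast_nonneg (α := ℝ)])
  have h' : IntegrableOn (fun r : ℝ => r ^ m * Real.exp (-r ^ 2 / 2 + r * z)) (Ioi 0) := by
    refine (h.const_mul (Real.exp (z ^ 2))).mono' (by fun_prop) ?_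
    filter_upwards [ae_restrict_mem measurableSet_Ioi] with r hr
    have hr : 0 < r := hr
    rw [Real.norm_of_nonneg (by positivity), Real.rpow_natCast, mul_left_comm, ← Real.exp_add]
    refine mul_le_mul_of_nonneg_left (Real.exp_le_exp.2 ?_) (by positivity)
    nlinarith [sq_nonneg (r / 2 - z)]
  exact h'.lintegral_lt_top.ne

/-- After the substitution `v = r T`, the moment integral at `δ T` is a mixture over `v > 0` of the
functions `exp (δ v)`. -/
theorem gaussMoment_mul_eq (m : ℕ) (δ : ℝ) {T : ℝ} (hT : 0 < T) :
    gaussMoment m (δ * T) = ENNReal.ofReal (T⁻¹ ^ (m + 1)) *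
      ∫⁻ v in Ioi 0, ENNReal.ofReal (v ^ m * Real.exp (-(v * T⁻¹) ^ 2 / 2 + v * δ)) := by
  rw [gaussMoment, lintegral_Ioi_comp_mul_left (inv_pos.2 hT) (by fun_prop), pow_succ',
    ENNReal.ofReal_mul (by positivity), mul_assoc]
  congr 1
  rw [← lintegral_const_mul _ (by fun_prop)]
  refine lintegral_congr fun v => ?_
  rw [← ENNReal.ofReal_mul (by positivity)]
  congr 1
  have h1 : T⁻¹ * v * (δ * T) = v * δ := by field_simp
  rw [h1, mul_pow, mul_comm T⁻¹ v]
  ring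

/-- Total positivity at positive arguments: both `exp (δ v)` and the mixing density of `v` given
`T` are totally positive of order two, and the composition formula combines them. -/
theorem gaussMoment_tp_of_pos (m : ℕ) {δ δ' T T' : ℝ} (hδ : δ ≤ δ') (hT : 0 < T) (hTT : T ≤ T') :
    gaussMoment m (δ' * T) * gaussMoment m (δ * T') ≤
      gaussMoment m (δ * T) * gaussMoment m (δ' * T') := by
  have hT' : 0 < T' := hT.trans_le hTT
  rw [gaussMoment_mul_eq m δ' hT, gaussMoment_mul_eq m δ hT', gaussMoment_mul_eq m δ hT,
    gaussMoment_mul_eq m δ' hT']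
  refine (mul_mul_mul_comm _ _ _ _).trans_le
    ((mul_le_mul' le_rfl ?_).trans (mul_mul_mul_comm _ _ _ _).le)
  apply lintegral_mul_lintegral_le_of_symm
  iterate 4 fun_prop
  filter_upwards [ae_restrict_mem measurableSet_Ioi] with x hx
  filter_upwards [ae_restrict_mem measurableSet_Ioi] with y hy
  have hx : 0 < x := hx
  have hy : 0 < y := hy
  rw [← ENNReal.ofReal_mul (by positivity), ← ENNReal.ofReal_mul (by positivity),
    ← ENNReal.ofReal_mul (by positivity), ← ENNReal.ofReal_mul (by positivity),
    ← ENNReal.ofReal_add (by positivity) (by positivity),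
    ← ENNReal.ofReal_add (by positivity) (by positivity)]
  refine ENNReal.ofReal_le_ofReal ?_
  have hinv : T'⁻¹ ^ 2 ≤ T⁻¹ ^ 2 := by gcongr
  simp only [mul_pow, Real.exp_add]
  -- the difference of the two sides is a product of two factors with the sign of `y - x`
  suffices H : 0 ≤ (x ^ m * y ^ m) *
      ((Real.exp (-(x ^ 2 * T⁻¹ ^ 2) / 2) * Real.exp (-(y ^ 2 * T'⁻¹ ^ 2) / 2) -
        Real.exp (-(y ^ 2 * T⁻¹ ^ 2) / 2) * Real.exp (-(x ^ 2 * T'⁻¹ ^ 2) / 2)) *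
      (Real.exp (x * δ) * Real.exp (y * δ') - Real.exp (x * δ') * Real.exp (y * δ))) by
    linarith
  refine mul_nonneg (by positivity) ?_
  simp only [← Real.exp_add]
  rcases le_total x y with h | h
  · refine mul_nonneg (sub_nonneg.2 (Real.exp_le_exp.2 ?_)) (sub_nonneg.2 (Real.exp_le_exp.2 ?_))
    · have : x ^ 2 ≤ y ^ 2 := by gcongr
      nlinarith
    · nlinarith
  · refine mul_nonneg_of_nonpos_of_nonpos (sub_nonpos.2 (Real.exp_le_exp.2 ?_))
      (sub_nonpos.2 (Real.exp_le_exp.2 ?_))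
    · have : y ^ 2 ≤ x ^ 2 := by gcongr
      nlinarith
    · nlinarith

/-- The kernel `(δ, T) ↦ gaussMoment m (δ * T)` is totally positive of order two. -/
theorem gaussMoment_tp (m : ℕ) {δ δ' T T' : ℝ} (hδ : δ ≤ δ') (hTT : T ≤ T') :
    gaussMoment m (δ' * T) * gaussMoment m (δ * T') ≤
      gaussMoment m (δ * T) * gaussMoment m (δ' * T') := by
  rcases lt_or_ge 0 T with hT | hT
  · exact gaussMoment_tp_of_pos m hδ hT hTT
  rcases lt_or_ge T' 0 with hT' | hT'
  · -- negating both arguments reverses both orders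
    have := gaussMoment_tp_of_pos m (neg_le_neg hδ) (neg_pos.2 hT') (neg_le_neg hTT)
    simp only [neg_mul_neg] at this
    rw [mul_comm, mul_comm (gaussMoment m (δ * T))]
    exact this
  · exact mul_le_mul' (gaussMoment_mono m (mul_le_mul_of_nonpos_right hδ hT))
      (gaussMoment_mono m (mul_le_mul_of_nonneg_right hδ hT'))

/-! ### Products of densities -/

theorem lintegral_pi_prod_eq {n : ℕ} {μ : Fin n → Measure ℝ} [∀ i, SigmaFinite (μ i)]
    {f : Fin n → ℝ → ℝ≥0∞} (hf : ∀ i, Measurable (f i)) :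
    ∫⁻ x, ∏ i, f i (x i) ∂Measure.pi μ = ∏ i, ∫⁻ x, f i x ∂μ i := by
  induction n with
  | zero => simp
  | succ n ih =>
    rw [← ((measurePreserving_piFinSuccAbove μ 0).symm).lintegral_comp (by fun_prop)]
    simp only [MeasurableEquiv.piFinSuccAbove_symm_apply, Fin.insertNthEquiv,
      Fin.prod_univ_succ, Fin.insertNth_zero, Equiv.coe_fn_mk, Fin.cons_zero, Fin.cons_succ,
      Fin.zero_succAbove]
    rw [← ih fun i => hf i.succ]
    exact lintegral_prod_mul (ν := Measure.pi fun i : Fin n => μ i.succ) (hf 0).aemeasurable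
      (g := fun x : Fin n → ℝ => ∏ i, f i.succ (x i)) 
      (Finset.univ.measurable_fun_prod fun i _ =>
        (hf i.succ).comp (measurable_pi_apply i)).aemeasurable

theorem pi_withDensity_eq {n : ℕ} {μ : Fin n → Measure ℝ} [∀ i, SigmaFinite (μ i)]
    {f : Fin n → ℝ → ℝ≥0∞} (hf : ∀ i, Measurable (f i))
    [∀ i, SigmaFinite ((μ i).withDensity (f i))] :
    Measure.pi (fun i => (μ i).withDensity (f i)) =
      (Measure.pi μ).withDensity fun x => ∏ i, f i (x i) := by
  refine Measure.pi_eq fun s hs => ?_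
  rw [withDensity_apply _ (.univ_pi hs), ← lintegral_indicator (.univ_pi hs)]
  have : (Set.univ.pi s).indicator (fun x : Fin n → ℝ => ∏ i, f i (x i)) =
      fun x => ∏ i, (s i).indicator (f i) (x i) := by
    ext x
    by_cases hx : x ∈ Set.univ.pi s
    · rw [indicator_of_mem hx]
      exact Finset.prod_congr rfl fun i _ => (indicator_of_mem (hx i (mem_univ i)) _).symm
    · rw [indicator_of_notMem hx]
      simp only [mem_univ_pi, not_forall] at hx
      obtain ⟨i, hi⟩ := hx
      exact (Finset.prod_eq_zero (Finset.mem_univ i) (indicator_of_notMem hi _)).symm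
  rw [this, lintegral_pi_prod_eq fun i => (hf i).indicator (hs i)]
  exact Finset.prod_congr rfl fun i _ => by
    rw [withDensity_apply _ (hs i), lintegral_indicator (hs i)]

/-! ### The reference measure and the density of the maximal invariants -/

/-- The reference measure for the `i`-th maximal invariant: counting measure on `{1, -1}` for the
first one, which is a sign, and Lebesgue measure for the others. -/
noncomputable def stepMeasure : ℕ → Measure ℝ
  | 0 => Measure.dirac 1 + Measure.dirac (-1)
  | _ + 1 => volume

instance (n : ℕ) : SigmaFinite (stepMeasure n) := by
  cases n <;> unfold stepMeasure <;> infer_instance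

/-- The reference measure for the first `n` maximal invariants. -/
noncomputable def refMeasure (n : ℕ) : Measure (Fin n → ℝ) :=
  Measure.pi fun i => stepMeasure i

instance (n : ℕ) : SigmaFinite (refMeasure n) := by
  unfold refMeasure; infer_instance

/-- The density of `U^n` at effect size `δ` with respect to `refMeasure n`; for `n ≥ 1` the
integration variable `s` is `|Y_1|`, and the data are `Y_i = s U_i`. -/
noncomputable def invariantDensity (δ : ℝ) : (n : ℕ) → (Fin n → ℝ) → ℝ≥0∞
  | 0, _ => 1
  | m + 1, u => ∫⁻ s in Ioi 0, ENNReal.ofReal (s ^ m) * ∏ i, gaussianPDF δ 1 (s * u i)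

@[fun_prop]
theorem measurable_invariantDensity (δ : ℝ) (n : ℕ) : Measurable (invariantDensity δ n) := by
  cases n with
  | zero => exact measurable_const
  | succ m =>
    unfold invariantDensity
    refine Measurable.lintegral_prod_right ?_
    simp only [Function.uncurry_def]
    fun_prop

theorem measurePreserving_snoc_refMeasure (n : ℕ) :
    MeasurePreserving (fun p : (Fin n → ℝ) × ℝ => (Fin.snoc p.1 p.2 : Fin (n + 1) → ℝ))
      ((refMeasure n).prod (stepMeasure n)) (refMeasure (n + 1)) := by
  have h := (measurePreserving_piFinSuccAbove (fun i : Fin (n + 1) => stepMeasure i)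
    (Fin.last n)).symm
  have h' := h.comp (Measure.measurePreserving_swap
    (μ := Measure.pi fun j : Fin n => stepMeasure ((Fin.last n).succAbove j))
    (ν := stepMeasure (Fin.last n)))
  simp only [Fin.succAbove_last, Fin.val_castSucc, Fin.val_last] at h'
  convert! h' using 1
  ext p i
  simp [MeasurableEquiv.piFinSuccAbove_symm_apply, Fin.insertNthEquiv]

theorem measurePreserving_cons {m : ℕ} (μ : Fin (m + 1) → Measure ℝ) [∀ i, SigmaFinite (μ i)] :
    MeasurePreserving (fun p : ℝ × (Fin m → ℝ) => (Fin.cons p.1 p.2 : Fin (m + 1) → ℝ))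
      ((μ 0).prod (Measure.pi fun i : Fin m => μ i.succ)) (Measure.pi μ) := by
  have h := (measurePreserving_piFinSuccAbove μ 0).symm
  simp only [Fin.succAbove_zero] at h
  convert! h using 1
  ext p i
  simp [MeasurableEquiv.piFinSuccAbove_symm_apply, Fin.insertNthEquiv]

@[fun_prop]
theorem measurable_snoc (n : ℕ) :
    Measurable fun p : (Fin n → ℝ) × ℝ => (Fin.snoc p.1 p.2 : Fin (n + 1) → ℝ) :=
  (measurePreserving_snoc_refMeasure n).measurable

@[fun_prop]
theorem measurable_cons (m : ℕ) :
    Measurable fun p : ℝ × (Fin m → ℝ) => (Fin.cons p.1 p.2 : Fin (m + 1) → ℝ) :=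
  (measurePreserving_cons fun _ : Fin (m + 1) => volume).measurable

theorem lintegral_refMeasure_succ {n : ℕ} {f : (Fin (n + 1) → ℝ) → ℝ≥0∞} (hf : Measurable f) :
    ∫⁻ v, f v ∂refMeasure (n + 1) =
      ∫⁻ u, ∫⁻ x, f (Fin.snoc u x) ∂stepMeasure n ∂refMeasure n := by
  rw [← (measurePreserving_snoc_refMeasure n).lintegral_comp hf]
  exact lintegral_prod _ (hf.comp (measurable_snoc n)).aemeasurable

theorem lintegral_stepMeasure_zero {g : ℝ → ℝ≥0∞} (hg : Measurable g) :
    ∫⁻ e, g e ∂stepMeasure 0 = g 1 + g (-1) := by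
  rw [stepMeasure, lintegral_add_measure, lintegral_dirac' _ hg, lintegral_dirac' _ hg]

/-- Polar coordinates on the line. -/
theorem lintegral_eq_lintegral_Ioi_add_neg {g : ℝ → ℝ≥0∞} (hg : Measurable g) :
    ∫⁻ y, g y = ∫⁻ s in Ioi 0, (g s + g (-s)) := by
  have h : ∫⁻ y in Iic 0, g y = ∫⁻ s in Ioi 0, g (-s) := by
    rw [setLIntegral_congr Iio_ae_eq_Iic.symm,
      ← (Measure.measurePreserving_neg volume).setLIntegral_comp_preimage measurableSet_Iio hg]
    simp
  rw [lintegral_add_left hg, ← h, ← lintegral_add_compl g (measurableSet_Ioi (a := (0 : ℝ))),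
    compl_Ioi]

theorem lintegral_pi_comp_smul {m : ℕ} {s : ℝ} (hs : 0 < s) {g : (Fin m → ℝ) → ℝ≥0∞}
    (hg : Measurable g) :
    ∫⁻ y, g y = ENNReal.ofReal (s ^ m) * ∫⁻ x, g (s • x) := by
  have h : ∫⁻ x, g (s • x) = ENNReal.ofReal ((s ^ m)⁻¹) * ∫⁻ y, g y := by
    have := Measure.map_addHaar_smul (volume : Measure (Fin m → ℝ)) hs.ne'
    rw [← lintegral_map hg (by fun_prop), this, lintegral_smul_measure, smul_eq_mul,
      abs_of_pos (by positivity)]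
    simp
  rw [h, ← mul_assoc, ← ENNReal.ofReal_mul (by positivity), mul_inv_cancel₀ (by positivity)]
  simp

/-! ### The law of the maximal invariants -/

theorem infinitePi_map_fin (μ : Measure ℝ) [IsProbabilityMeasure μ] (n : ℕ) :
    (Measure.infinitePi fun _ : ℕ => μ).map (fun y (i : Fin n) => y i) =
      Measure.pi fun _ : Fin n => μ := by
  refine (Measure.pi_eq fun s hs => ?_).symm
  rw [Measure.map_apply (by fun_prop) (.univ_pi hs)]
  have : (fun (y : ℕ → ℝ) (i : Fin n) => y i) ⁻¹' Set.univ.pi s =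
      Set.pi (Finset.range n) fun i => if h : i < n then s ⟨i, h⟩ else Set.univ := by
    ext y
    simp only [mem_preimage, Set.mem_pi, Finset.coe_range, mem_Iio]
    exact ⟨fun h i hi => by simpa [hi] using h ⟨i, hi⟩, fun h i => by simpa using h i i.2⟩
  rw [this, Measure.infinitePi_pi, Finset.prod_range]
  · simp
  · intro i hi
    simp only [Finset.mem_range] at hi
    simpa [hi] using hs _

theorem measurable_maximalInvariant : Measurable maximalInvariant := by
  unfold maximalInvariant
  fun_prop

theorem invariantVecLaw_eq_map (δ : ℝ) (n : ℕ) :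
    invariantVecLaw δ n =
      (Measure.infinitePi fun _ : ℕ => gaussianReal δ 1).map (invariantVec n) := by
  rw [invariantVecLaw, invariantLaw, Measure.map_map (by fun_prop) measurable_maximalInvariant]
  rfl

instance (δ : ℝ) (n : ℕ) : IsProbabilityMeasure (invariantVecLaw δ n) := by
  rw [invariantVecLaw_eq_map]
  exact Measure.isProbabilityMeasure_map (measurable_invariantVec n).aemeasurable

/-- The law of the maximal invariants depends on mean and scale only through the effect size. -/
theorem infinitePi_map_maximalInvariant (μ : ℝ) {σ : ℝ≥0} (hσ : 0 < σ) :
    (Measure.infinitePi fun _ : ℕ => gaussianReal μ (σ ^ 2)).map maximalInvariant =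
      invariantLaw (μ / (σ : ℝ)) := by
  have hσ' : (0 : ℝ) < σ := hσ
  have h : (gaussianReal (μ / (σ : ℝ)) 1).map (fun x => (σ : ℝ) * x) =
      gaussianReal μ (σ ^ 2) := by
    rw [gaussianReal_map_const_mul]
    congr 1
    · field_simp
    · ext; simp
  have h2 := Measure.infinitePi_map_pi (fun _ : ℕ => gaussianReal (μ / (σ : ℝ)) 1)
    (f := fun _ x => (σ : ℝ) * x) fun _ => by fun_prop
  simp only [h] at h2
  rw [← h2, Measure.map_map measurable_maximalInvariant (by fun_prop), invariantLaw]
  congr 1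
  ext y i
  simp only [Function.comp_apply, maximalInvariant, abs_mul, abs_of_pos hσ']
  exact mul_div_mul_left _ _ hσ'.ne'

theorem pi_gaussianReal_eq (δ : ℝ) (n : ℕ) :
    (Measure.pi fun _ : Fin n => gaussianReal δ 1) =
      volume.withDensity fun y => ∏ i, gaussianPDF δ 1 (y i) := by
  have h : gaussianReal δ 1 = volume.withDensity (gaussianPDF δ 1) :=
    gaussianReal_of_var_ne_zero δ one_ne_zero
  have : SigmaFinite ((volume : Measure ℝ).withDensity (gaussianPDF δ 1)) := h ▸ inferInstance
  rw [h, volume_pi]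
  exact pi_withDensity_eq fun _ => measurable_gaussianPDF δ 1

/-- The density of `U^n`: write the first observation as `± s` and rescale the others by `s`. -/
theorem invariantVecLaw_eq_withDensity (δ : ℝ) (n : ℕ) :
    invariantVecLaw δ n = (refMeasure n).withDensity (invariantDensity δ n) := by
  cases n with
  | zero =>
    refine Measure.ext_of_singleton fun u => ?_
    have hu : ({u} : Set (Fin 0 → ℝ)) = Set.univ := Set.eq_univ_of_forall fun v =>
      Subsingleton.elim v u
    rw [hu, measure_univ]
    simp [invariantDensity, refMeasure]
  | succ m =>
    refine Measure.ext_of_lintegral _ fun f hf => ?_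
    have hvec : invariantVec (m + 1) =
        (fun (y : Fin (m + 1) → ℝ) i => y i / |y 0|) ∘ fun (y : ℕ → ℝ) (i : Fin (m + 1)) => y i :=
      rfl
    rw [invariantVecLaw_eq_map, hvec, ← Measure.map_map (by fun_prop) (by fun_prop),
      infinitePi_map_fin, lintegral_map hf (by fun_prop), pi_gaussianReal_eq,
      lintegral_withDensity_eq_lintegral_mul _ (by fun_prop) (by fun_prop),
      lintegral_withDensity_eq_lintegral_mul _ (by fun_prop) (by fun_prop)]
    -- the integrand in the coordinates `s = |Y_1|`, `e = sign Y_1`, `x_i = Y_{i+1} / s`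
    set F : ℝ → ℝ → (Fin m → ℝ) → ℝ≥0∞ := fun s e x =>
      ENNReal.ofReal (s ^ m) * (∏ i, gaussianPDF δ 1 (s * (Fin.cons e x : Fin (m + 1) → ℝ) i)) *
        f (Fin.cons e x) with hF
    have hFm : Measurable fun p : ℝ × ℝ × (Fin m → ℝ) => F p.1 p.2.1 p.2.2 := by
      have hc : Measurable fun p : ℝ × ℝ × (Fin m → ℝ) =>
        (Fin.cons p.2.1 p.2.2 : Fin (m + 1) → ℝ) := (measurable_cons m).comp measurable_snd
      have hci : ∀ i, Measurable fun p : ℝ × ℝ × (Fin m → ℝ) =>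
        (Fin.cons p.2.1 p.2.2 : Fin (m + 1) → ℝ) i := fun i => (measurable_pi_apply i).comp hc
      have hfc := hf.comp hc
      have := measurable_gaussianPDF δ 1
      simp only [hF]
      fun_prop
    -- the integrand in the original coordinates, and its integral over all but the first one
    set I : ℝ → (Fin m → ℝ) → ℝ≥0∞ := fun y₀ y =>
      (∏ i, gaussianPDF δ 1 ((Fin.cons y₀ y : Fin (m + 1) → ℝ) i)) *
        f (fun i => (Fin.cons y₀ y : Fin (m + 1) → ℝ) i / |y₀|) with hI
    set G : ℝ → ℝ≥0∞ := fun y₀ => ∫⁻ y, I y₀ y with hG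
    have hIm : Measurable fun p : ℝ × (Fin m → ℝ) => I p.1 p.2 := by
      have hcm : ∀ i, Measurable fun p : ℝ × (Fin m → ℝ) =>
          (Fin.cons p.1 p.2 : Fin (m + 1) → ℝ) i :=
        fun i => (measurable_pi_apply i).comp (measurable_cons m)
      simp only [hI]
      fun_prop
    have hGm : Measurable G := Measurable.lintegral_prod_right hIm
    have hIa : ∀ a, Measurable (I a) := fun a =>
      Measurable.comp (g := fun p : ℝ × (Fin m → ℝ) => I p.1 p.2) (f := fun y => (a, y)) hIm
        measurable_prodMk_left
    -- an opaque `I` keeps the unifier from unfolding the normal densities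
    clear_value I
    have hGF : ∀ s : ℝ, 0 < s → ∀ e : ℝ, |e| = 1 → G (s * e) = ∫⁻ x, F s e x := by
      intro s hs e he
      simp only [hG]
      rw [lintegral_pi_comp_smul hs (hIa _),
        ← lintegral_const_mul (f := fun x => I (s * e) (s • x)) _
          ((hIa _).comp (measurable_const_smul s))]
      refine lintegral_congr fun x => ?_
      have hcons : (Fin.cons (s * e) (s • x) : Fin (m + 1) → ℝ) =
          fun i => s * (Fin.cons e x : Fin (m + 1) → ℝ) i := by
        ext i
        cases i using Fin.cases <;> simp
      simp only [hI, hF]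
      rw [hcons, abs_mul, he, abs_of_pos hs, mul_one, mul_assoc]
      simp only [mul_div_cancel_left₀ _ hs.ne']
    have lhs : ∫⁻ y : Fin (m + 1) → ℝ, (∏ i, gaussianPDF δ 1 (y i)) * f (fun i => y i / |y 0|) =
        ∫⁻ s in Ioi 0, ∫⁻ e, ∫⁻ x, F s e x ∂volume ∂stepMeasure 0 := by
      rw [volume_pi, ← (measurePreserving_cons fun _ : Fin (m + 1) => volume).lintegral_comp
        (by fun_prop)]
      refine (lintegral_congr (g := fun p => I p.1 p.2) fun p => by
        simp only [hI, Fin.cons_zero]).trans ?_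
      refine (lintegral_prod (μ := volume) (ν := Measure.pi fun _ : Fin m => volume)
        (fun p : ℝ × (Fin m → ℝ) => I p.1 p.2) hIm.aemeasurable).trans ?_
      refine (lintegral_eq_lintegral_Ioi_add_neg hGm).trans ?_
      refine setLIntegral_congr_fun measurableSet_Ioi fun s hs => ?_
      have hs : 0 < s := hs
      have hFs : Measurable fun e => ∫⁻ x, F s e x :=
        Measurable.lintegral_prod_right (hFm.comp measurable_prodMk_left)
      rw [lintegral_stepMeasure_zero hFs, ← hGF s hs 1 (by simp), ← hGF s hs (-1) (by simp)]
      simp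
    have hsm : ∀ u : Fin (m + 1) → ℝ, Measurable fun s : ℝ =>
        ENNReal.ofReal (s ^ m) * ∏ i, gaussianPDF δ 1 (s * u i) := fun u => by fun_prop
    have rhs : ∫⁻ u, invariantDensity δ (m + 1) u * f u ∂refMeasure (m + 1) =
        ∫⁻ e, ∫⁻ x, ∫⁻ s in Ioi 0, F s e x ∂volume ∂volume ∂stepMeasure 0 := by
      rw [refMeasure, ← (measurePreserving_cons fun i : Fin (m + 1) => stepMeasure i).lintegral_comp
        (by fun_prop)]
      refine (lintegral_prod _ (Measurable.aemeasurable ?_)).trans ?_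
      · exact ((measurable_invariantDensity δ (m + 1)).mul hf).comp (measurable_cons m)
      refine lintegral_congr fun e => lintegral_congr fun x => ?_
      simp only [invariantDensity, hF]
      rw [← lintegral_mul_const _ (hsm _)]
    refine lhs.trans (Eq.trans ?_ rhs.symm)
    rw [lintegral_lintegral_swap]
    · refine lintegral_congr fun e => lintegral_lintegral_swap ?_
      refine Measurable.aemeasurable (Measurable.comp (g := fun p : ℝ × ℝ × (Fin m → ℝ) =>
        F p.1 p.2.1 p.2.2) hFm (f := fun p : ℝ × (Fin m → ℝ) => (p.1, e, p.2)) (by fun_prop))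
    · refine Measurable.aemeasurable (Measurable.lintegral_prod_right ?_)
      exact Measurable.comp (g := fun p : ℝ × ℝ × (Fin m → ℝ) => F p.1 p.2.1 p.2.2) hFm
        (f := fun p : (ℝ × ℝ) × (Fin m → ℝ) => (p.1.1, p.1.2, p.2)) (by fun_prop)

/-! ### Properties of the density -/

theorem lintegral_gaussianPDF_mul_left (δ : ℝ) {s : ℝ} (hs : 0 < s) :
    ENNReal.ofReal s * ∫⁻ x, gaussianPDF δ 1 (s * x) = 1 := by
  rw [← lintegral_gaussianPDF_eq_one δ one_ne_zero,
    ← lintegral_map (f := gaussianPDF δ 1) (by fun_prop) (measurable_const_mul s)]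
  conv_rhs => rw [← Real.smul_map_volume_mul_left hs.ne']
  rw [lintegral_smul_measure, abs_of_pos hs, smul_eq_mul]

/-- The densities are consistent: integrating out the last coordinate of the density of `U^{n+1}`
gives the density of `U^n`. -/
theorem lintegral_invariantDensity_snoc (δ : ℝ) (n : ℕ) (u : Fin n → ℝ) :
    ∫⁻ x, invariantDensity δ (n + 1) (Fin.snoc u x) ∂stepMeasure n = invariantDensity δ n u := by
  have hsn : Measurable fun x : ℝ => (Fin.snoc u x : Fin (n + 1) → ℝ) :=
    (measurable_snoc n).comp measurable_prodMk_left
  cases n with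
  | zero =>
    rw [lintegral_stepMeasure_zero (g := fun x => invariantDensity δ (0 + 1) (Fin.snoc u x))
      ((measurable_invariantDensity δ 1).comp hsn)]
    have h : ∀ x : ℝ, invariantDensity δ 1 (Fin.snoc u x) =
        ∫⁻ s in Ioi 0, gaussianPDF δ 1 (s * x) := fun x => by
      simp [invariantDensity, Fin.snoc]
    rw [h, h, ← lintegral_add_left (by fun_prop), invariantDensity,
      ← lintegral_gaussianPDF_eq_one δ one_ne_zero,
      lintegral_eq_lintegral_Ioi_add_neg (measurable_gaussianPDF δ 1)]
    simp
  | succ m =>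
    simp only [invariantDensity, stepMeasure, Fin.prod_univ_castSucc (n := m + 1),
      Fin.snoc_castSucc, Fin.snoc_last]
    rw [lintegral_lintegral_swap]
    · refine setLIntegral_congr_fun measurableSet_Ioi fun s hs => ?_
      have hs : 0 < s := hs
      rw [lintegral_const_mul _ (by fun_prop), lintegral_const_mul _ (by fun_prop), pow_succ,
        ENNReal.ofReal_mul (by positivity)]
      rw [mul_mul_mul_comm, lintegral_gaussianPDF_mul_left δ hs, mul_one]
    · refine Measurable.aemeasurable ?_
      simp only [Function.uncurry_def]
      fun_prop

theorem invariantDensity_ne_zero (δ : ℝ) (n : ℕ) (u : Fin n → ℝ) :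
    invariantDensity δ n u ≠ 0 := by
  cases n with
  | zero => exact one_ne_zero
  | succ m =>
    have hm : Measurable fun s : ℝ =>
        ENNReal.ofReal (s ^ m) * ∏ i, gaussianPDF δ 1 (s * u i) := by fun_prop
    refine (setLIntegral_pos_iff hm).2 ?_ |>.ne'
    have : Ioi (0 : ℝ) ⊆ Function.support (fun s : ℝ =>
        ENNReal.ofReal (s ^ m) * ∏ i, gaussianPDF δ 1 (s * u i)) := fun s hs => by
      have hs : 0 < s := hs
      refine mul_ne_zero (ENNReal.ofReal_pos.2 (by positivity)).ne' ?_
      exact Finset.prod_ne_zero_iff.2 fun i _ => (gaussianPDF_pos δ one_ne_zero _).ne'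
    rw [inter_eq_self_of_subset_right this]
    simp

/-- The sum of the data normalised by their Euclidean norm, a strictly increasing function of the
t-statistic. -/
noncomputable def normalizedSum {n : ℕ} (u : Fin n → ℝ) : ℝ :=
  (∑ i, u i) * (√(∑ i, u i ^ 2))⁻¹

/-- The density of `U^n` involves the effect size and the data jointly only through `δ T`, where `T`
is the normalised sum. -/
theorem invariantDensity_eq_gaussMoment (δ : ℝ) {m : ℕ} {u : Fin (m + 1) → ℝ}
    (hu : 0 < ∑ i, u i ^ 2) :
    invariantDensity δ (m + 1) u =
      ENNReal.ofReal ((√(2 * Real.pi))⁻¹ ^ (m + 1) * Real.exp (-((m + 1) * δ ^ 2) / 2)) *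
        ENNReal.ofReal ((√(∑ i, u i ^ 2))⁻¹ ^ (m + 1)) * gaussMoment m (δ * normalizedSum u) := by
  set c : ℝ := (√(∑ i, u i ^ 2))⁻¹ with hc
  have hc0 : 0 < c := inv_pos.2 (Real.sqrt_pos.2 hu)
  have hca : c ^ 2 * ∑ i, u i ^ 2 = 1 := by
    rw [hc, inv_pow, Real.sq_sqrt hu.le, inv_mul_cancel₀ hu.ne']
  rw [invariantDensity, lintegral_Ioi_comp_mul_left hc0 (by fun_prop), gaussMoment,
    ← lintegral_const_mul _ (by fun_prop), ← lintegral_const_mul _ (by fun_prop)]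
  refine setLIntegral_congr_fun measurableSet_Ioi fun r hr => ?_
  have hr : 0 < r := hr
  simp only [gaussianPDF]
  rw [← ENNReal.ofReal_prod_of_nonneg fun i _ => gaussianPDFReal_nonneg _ _ _,
    ← ENNReal.ofReal_mul (by positivity), ← ENNReal.ofReal_mul (by positivity),
    ← ENNReal.ofReal_mul (by positivity), ← ENNReal.ofReal_mul (by positivity)]
  congr 1
  simp only [gaussianPDFReal, NNReal.coe_one, mul_one, Finset.prod_mul_distrib, Finset.prod_const,
    Finset.card_univ, Fintype.card_fin, ← Real.exp_sum]
  have hsum : ∑ i, -(c * r * u i - δ) ^ 2 / 2 =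
      -((m + 1) * δ ^ 2) / 2 + (-r ^ 2 / 2 + r * (δ * normalizedSum u)) := by
    have : ∀ i, -(c * r * u i - δ) ^ 2 / 2 =
        -(c ^ 2 * r ^ 2) / 2 * u i ^ 2 + c * r * δ * u i - δ ^ 2 / 2 := fun i => by ring
    simp only [this, Finset.sum_sub_distrib, Finset.sum_add_distrib, ← Finset.mul_sum,
      Finset.sum_const, Finset.card_univ, Fintype.card_fin, nsmul_eq_mul, normalizedSum, ← hc]
    push_cast
    linear_combination (-r ^ 2 / 2) * hca
  rw [hsum, Real.exp_add]
  ring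

theorem invariantDensity_ne_top (δ : ℝ) {m : ℕ} {u : Fin (m + 1) → ℝ}
    (hu : 0 < ∑ i, u i ^ 2) : invariantDensity δ (m + 1) u ≠ ∞ := by
  rw [invariantDensity_eq_gaussMoment δ hu]
  exact ENNReal.mul_ne_top (ENNReal.mul_ne_top ENNReal.ofReal_ne_top ENNReal.ofReal_ne_top)
    (gaussMoment_ne_top _ _)

/-- Monotone likelihood ratio: the density at `δ'` relative to the one at `δ ≤ δ'` is a
nondecreasing function of the normalised sum. -/
theorem invariantDensity_mul_le {δ δ' : ℝ} (hδ : δ ≤ δ') {m : ℕ} {u v : Fin (m + 1) → ℝ}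
    (hu : 0 < ∑ i, u i ^ 2) (hv : 0 < ∑ i, v i ^ 2) (huv : normalizedSum u ≤ normalizedSum v) :
    invariantDensity δ' (m + 1) u * invariantDensity δ (m + 1) v ≤
      invariantDensity δ (m + 1) u * invariantDensity δ' (m + 1) v := by
  rw [invariantDensity_eq_gaussMoment δ hu, invariantDensity_eq_gaussMoment δ hv,
    invariantDensity_eq_gaussMoment δ' hu, invariantDensity_eq_gaussMoment δ' hv,
    mul_mul_mul_comm, mul_mul_mul_comm _ (gaussMoment m (δ * normalizedSum u))]
  refine mul_le_mul' (le_of_eq (by ring)) (gaussMoment_tp m hδ huv)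

theorem ae_refMeasure_sum_sq_pos (m : ℕ) :
    ∀ᵐ u ∂refMeasure (m + 1), 0 < ∑ i, u i ^ 2 := by
  have h : refMeasure (m + 1) {0} = 0 := by
    rw [refMeasure, Measure.pi_singleton]
    exact Finset.prod_eq_zero (Finset.mem_univ 0) (by simp [stepMeasure])
  filter_upwards [compl_mem_ae_iff.2 h] with u hu
  refine lt_of_le_of_ne (by positivity) fun h0 => hu ?_
  ext i
  have := (Finset.sum_eq_zero_iff_of_nonneg fun i _ => sq_nonneg (u i)).1 h0.symm i
    (Finset.mem_univ i)
  simpa using this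

theorem ae_invariantDensity_ne_top (δ : ℝ) (n : ℕ) :
    ∀ᵐ u ∂refMeasure n, invariantDensity δ n u ≠ ∞ := by
  cases n with
  | zero => exact .of_forall fun _ => ENNReal.one_ne_top
  | succ m => exact (ae_refMeasure_sum_sq_pos m).mono fun u hu => invariantDensity_ne_top δ hu

/-! ### The likelihood ratio -/

theorem invariantVecLaw_absolutelyContinuous (δ δ' : ℝ) (n : ℕ) :
    invariantVecLaw δ n ≪ invariantVecLaw δ' n := by
  rw [invariantVecLaw_eq_withDensity δ, invariantVecLaw_eq_withDensity δ']
  exact (withDensity_absolutelyContinuous _ _).trans (withDensity_absolutelyContinuous'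
    (by fun_prop) (.of_forall fun u => invariantDensity_ne_zero δ' n u))

theorem rnDeriv_invariantVecLaw (δ δ₀ δ₁ : ℝ) (n : ℕ) :
    (invariantVecLaw δ₁ n).rnDeriv (invariantVecLaw δ₀ n) =ᵐ[invariantVecLaw δ n]
      fun u => invariantDensity δ₁ n u / invariantDensity δ₀ n u := by
  refine (invariantVecLaw_absolutelyContinuous δ δ₀ n).ae_le ?_
  have hm : Measurable fun u => invariantDensity δ₁ n u / invariantDensity δ₀ n u := by fun_prop
  have h : invariantVecLaw δ₁ n = (invariantVecLaw δ₀ n).withDensity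
      fun u => invariantDensity δ₁ n u / invariantDensity δ₀ n u := by
    rw [invariantVecLaw_eq_withDensity δ₁, invariantVecLaw_eq_withDensity δ₀,
      ← withDensity_mul _ (by fun_prop) hm]
    refine withDensity_congr_ae ?_
    filter_upwards [ae_invariantDensity_ne_top δ₀ n] with u hu
    exact (ENNReal.mul_div_cancel (invariantDensity_ne_zero δ₀ n u) hu).symm
  rw [h]
  exact Measure.rnDeriv_withDensity _ hm

/-- The pointwise inequality behind Chebyshev's inequality, for two points at which three densities
take the values `p, q, r` and `p', q', r'`: the ratio `p / r` does not decrease and `q / r` does not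
increase from the first point to the second. -/
theorem antivary_mul_add_le {p p' q q' r r' : ℝ≥0∞} (hr : r ≠ 0) (hr' : r' ≠ 0) (hp : p ≠ ∞)
    (hp' : p' ≠ ∞) (hq : q ≠ ∞) (hq' : q' ≠ ∞) (hrt : r ≠ ∞) (hrt' : r' ≠ ∞)
    (h1 : p * r' ≤ r * p') (h2 : r * q' ≤ q * r') :
    q * (p / r) * r' + q' * (p' / r') * r ≤ p * q' + p' * q := by
  lift p to ℝ≥0 using hp
  lift p' to ℝ≥0 using hp'
  lift q to ℝ≥0 using hq
  lift q' to ℝ≥0 using hq'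
  lift r to ℝ≥0 using hrt
  lift r' to ℝ≥0 using hrt'
  have hr : r ≠ 0 := by simpa using hr
  have hr' : r' ≠ 0 := by simpa using hr'
  rw [← ENNReal.coe_div hr, ← ENNReal.coe_div hr']
  norm_cast at h1 h2 ⊢
  rw [← NNReal.coe_le_coe] at h1 h2 ⊢
  push_cast at h1 h2 ⊢
  have hr0 : (0 : ℝ) < r := by positivity
  have hr0' : (0 : ℝ) < r' := by positivity
  have key : (q : ℝ) * (p / r) * r' + q' * (p' / r') * r - (p * q' + p' * q) =
      -((r * p' - p * r') * (q * r' - r * q')) / (r * r') := by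
    field_simp
    ring
  have : -(((r : ℝ) * p' - p * r') * (q * r' - r * q')) / (r * r') ≤ 0 :=
    div_nonpos_of_nonpos_of_nonneg
      (neg_nonpos.2 (mul_nonneg (sub_nonneg.2 h1) (sub_nonneg.2 h2))) (by positivity)
  linarith

/-- One step of the supermartingale property, conditionally on `U^n = u`. As functions of the new
coordinate, the ratio of the densities at `δ₁` and `δ₀` and the ratio of those at `δ` and `δ₀` are
monotone in opposite directions in the normalised sum of all `n + 1` coordinates. -/
theorem lintegral_likelihoodRatio_snoc_le {δ δ₀ δ₁ : ℝ} (hδ : δ ≤ δ₀) (hδ₁ : δ₀ ≤ δ₁) {n : ℕ}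
    {u : Fin n → ℝ} (hu : invariantDensity δ₀ n u ≠ ∞)
    (hpos : ∀ᵐ x ∂stepMeasure n, 0 < ∑ i, (Fin.snoc u x : Fin (n + 1) → ℝ) i ^ 2) :
    ∫⁻ x, invariantDensity δ (n + 1) (Fin.snoc u x) *
        (invariantDensity δ₁ (n + 1) (Fin.snoc u x) /
          invariantDensity δ₀ (n + 1) (Fin.snoc u x)) ∂stepMeasure n ≤
      invariantDensity δ n u * (invariantDensity δ₁ n u / invariantDensity δ₀ n u) := by
  have hsn : Measurable fun x : ℝ => (Fin.snoc u x : Fin (n + 1) → ℝ) :=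
    (measurable_snoc n).comp measurable_prodMk_left
  have hq : ∀ δ, Measurable fun x : ℝ => invariantDensity δ (n + 1) (Fin.snoc u x) :=
    fun δ => (measurable_invariantDensity δ (n + 1)).comp hsn
  have key := lintegral_mul_lintegral_le_of_symm (ν := stepMeasure n)
    ((hq δ).mul ((hq δ₁).div (hq δ₀))) (hq δ₁) (hq δ) (hq δ₀) (by
      filter_upwards [hpos] with x hx
      filter_upwards [hpos] with y hy
      have step : ∀ v w : Fin (n + 1) → ℝ, 0 < ∑ i, v i ^ 2 → 0 < ∑ i, w i ^ 2 →
          normalizedSum v ≤ normalizedSum w → _ := fun v w hv hw h =>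
        antivary_mul_add_le (invariantDensity_ne_zero δ₀ _ v) (invariantDensity_ne_zero δ₀ _ w)
          (invariantDensity_ne_top δ₁ hv) (invariantDensity_ne_top δ₁ hw)
          (invariantDensity_ne_top δ hv) (invariantDensity_ne_top δ hw)
          (invariantDensity_ne_top δ₀ hv) (invariantDensity_ne_top δ₀ hw)
          (invariantDensity_mul_le hδ₁ hv hw h) (invariantDensity_mul_le hδ hv hw h)
      rcases le_total (normalizedSum (Fin.snoc u x : Fin (n + 1) → ℝ))
        (normalizedSum (Fin.snoc u y : Fin (n + 1) → ℝ)) with h | h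
      · exact step _ _ hx hy h
      · exact (add_comm _ _).trans_le ((step _ _ hy hx h).trans (add_comm _ _).le))
  simp only [lintegral_invariantDensity_snoc] at key
  rw [← mul_div_assoc, mul_comm (invariantDensity δ n u)]
  exact (ENNReal.le_div_iff_mul_le (.inl (invariantDensity_ne_zero δ₀ n u)) (.inl hu)).2 key

/-- The supermartingale inequality, integrated over an event of `σ(U^n)`. -/
theorem setLIntegral_rnDeriv_succ_le {δ δ₀ δ₁ : ℝ} (hδ : δ ≤ δ₀) (hδ₁ : δ₀ ≤ δ₁) {n : ℕ}
    {S : Set (Fin n → ℝ)} (hS : MeasurableSet S) :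
    ∫⁻ v in (fun v : Fin (n + 1) → ℝ => fun i : Fin n => v i.castSucc) ⁻¹' S,
        (invariantVecLaw δ₁ (n + 1)).rnDeriv (invariantVecLaw δ₀ (n + 1)) v
          ∂invariantVecLaw δ (n + 1) ≤
      ∫⁻ u in S, (invariantVecLaw δ₁ n).rnDeriv (invariantVecLaw δ₀ n) u
        ∂invariantVecLaw δ n := by
  have hS' : MeasurableSet ((fun v : Fin (n + 1) → ℝ => fun i : Fin n => v i.castSucc) ⁻¹' S) :=
    hS.preimage (by fun_prop)
  rw [lintegral_congr_ae (ae_restrict_of_ae (rnDeriv_invariantVecLaw δ δ₀ δ₁ (n + 1))),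
    lintegral_congr_ae (ae_restrict_of_ae (rnDeriv_invariantVecLaw δ δ₀ δ₁ n)),
    invariantVecLaw_eq_withDensity, invariantVecLaw_eq_withDensity,
    setLIntegral_withDensity_eq_setLIntegral_mul _ (by fun_prop) (by fun_prop) hS',
    setLIntegral_withDensity_eq_setLIntegral_mul _ (by fun_prop) (by fun_prop) hS,
    ← lintegral_indicator hS', ← lintegral_indicator hS,
    lintegral_refMeasure_succ (Measurable.indicator (by fun_prop) hS')]
  have hpos : ∀ᵐ u ∂refMeasure n, ∀ᵐ x ∂stepMeasure n,
      0 < ∑ i, (Fin.snoc u x : Fin (n + 1) → ℝ) i ^ 2 :=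
    Measure.ae_ae_of_ae_prod
      ((measurePreserving_snoc_refMeasure n).quasiMeasurePreserving.ae
        (ae_refMeasure_sum_sq_pos n))
  refine lintegral_mono_ae ?_
  filter_upwards [hpos, ae_invariantDensity_ne_top δ₀ n] with u hu htop
  by_cases huS : u ∈ S
  · rw [indicator_of_mem huS]
    refine le_trans (lintegral_mono fun x => indicator_le_self _ _ _) ?_
    exact lintegral_likelihoodRatio_snoc_le hδ hδ₁ htop hu
  · rw [indicator_of_notMem huS]
    refine (lintegral_eq_zero_of_ae_eq_zero (.of_forall fun x => indicator_of_notMem ?_ _)).le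
    simpa using huS

theorem likelihoodRatio_zero (δ₀ δ₁ : ℝ) (u : Fin 0 → ℝ) : likelihoodRatio δ₀ δ₁ 0 u = 1 := by
  have h := rnDeriv_invariantVecLaw δ₀ δ₀ δ₁ 0
  obtain ⟨v, hv⟩ := h.exists
  rw [likelihoodRatio, Subsingleton.elim u v, hv]
  simp [invariantDensity]

theorem lintegral_rnDeriv_invariantVecLaw_le_one {δ δ₀ δ₁ : ℝ} (hδ : δ ≤ δ₀) (hδ₁ : δ₀ ≤ δ₁)
    (n : ℕ) :
    ∫⁻ u, (invariantVecLaw δ₁ n).rnDeriv (invariantVecLaw δ₀ n) u ∂invariantVecLaw δ n ≤ 1 := by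
  induction n with
  | zero =>
    rw [lintegral_congr_ae (rnDeriv_invariantVecLaw δ δ₀ δ₁ 0)]
    simp [invariantDensity]
  | succ n ih =>
    have h := setLIntegral_rnDeriv_succ_le hδ hδ₁ (n := n) MeasurableSet.univ
    rw [preimage_univ, setLIntegral_univ, setLIntegral_univ] at h
    exact h.trans ih

/-! ### The test supermartingale -/

theorem map_invariantVec_eq {Ω : Type*} [MeasurableSpace Ω] {Y : ℕ → Ω → ℝ}
    (hY : ∀ i, Measurable (Y i)) {μ : ℝ} {σ : ℝ≥0} (hσ : 0 < σ) {P : Measure Ω}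
    [IsProbabilityMeasure P] (h : IsIIDNormal Y μ σ P) (n : ℕ) :
    P.map (fun ω => invariantVec n fun i => Y i ω) = invariantVecLaw (μ / (σ : ℝ)) n := by
  have h1 := h.indep.map_fun_eq_infinitePi_map hY
  simp only [h.law] at h1
  rw [invariantVecLaw, ← infinitePi_map_maximalInvariant μ hσ, ← h1,
    Measure.map_map measurable_maximalInvariant (measurable_pi_lambda _ hY),
    Measure.map_map (g := fun (u : ℕ → ℝ) (i : Fin n) => u i) (by fun_prop)
      (measurable_maximalInvariant.comp (measurable_pi_lambda _ hY))]
  rfl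

theorem supermartingale_likelihoodRatioProcess {Ω : Type*} [MeasurableSpace Ω] {Y : ℕ → Ω → ℝ}
    (hY : ∀ i, Measurable (Y i)) {δ₀ δ₁ : ℝ} (hδ₁ : δ₀ ≤ δ₁) {P : Measure Ω}
    (hP : P ∈ oneSidedNull Y δ₀) :
    Supermartingale (likelihoodRatioProcess Y δ₀ δ₁) (invariantFiltration Y hY) P := by
  obtain ⟨_, μ, σ, hσ, hδ, hiid⟩ := hP
  have hU : ∀ n, Measurable fun ω => invariantVec n fun i => Y i ω := fun n =>
    (measurable_invariantVec n).comp (measurable_pi_lambda _ hY)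
  have hL : ∀ n, Measurable (likelihoodRatio δ₀ δ₁ n) := fun n =>
    (Measure.measurable_rnDeriv _ _).ennreal_toReal
  -- integrals of the process over events of `σ(U^n)` are integrals under the law of `U^n`
  have hset : ∀ n (S : Set (Fin n → ℝ)), MeasurableSet S →
      ∫⁻ ω in (fun ω => invariantVec n fun i => Y i ω) ⁻¹' S,
        ENNReal.ofReal (likelihoodRatioProcess Y δ₀ δ₁ n ω) ∂P =
      ∫⁻ u in S, (invariantVecLaw δ₁ n).rnDeriv (invariantVecLaw δ₀ n) u
        ∂invariantVecLaw (μ / (σ : ℝ)) n := by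
    intro n S hS
    have h1 : ∫⁻ u in S, ENNReal.ofReal (likelihoodRatio δ₀ δ₁ n u)
          ∂invariantVecLaw (μ / (σ : ℝ)) n =
        ∫⁻ ω in (fun ω => invariantVec n fun i => Y i ω) ⁻¹' S,
          ENNReal.ofReal (likelihoodRatioProcess Y δ₀ δ₁ n ω) ∂P := by
      rw [← map_invariantVec_eq hY hσ hiid n,
        setLIntegral_map hS (hL n).ennreal_ofReal (hU n)]
      rfl
    rw [← h1]
    refine lintegral_congr_ae (ae_restrict_of_ae ?_)
    filter_upwards [(invariantVecLaw_absolutelyContinuous (μ / (σ : ℝ)) δ₀ n).ae_le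
      (Measure.rnDeriv_lt_top (invariantVecLaw δ₁ n) (invariantVecLaw δ₀ n))] with u hu
    exact ENNReal.ofReal_toReal hu.ne
  have hnonneg : ∀ n ω, 0 ≤ likelihoodRatioProcess Y δ₀ δ₁ n ω := fun _ _ =>
    ENNReal.toReal_nonneg
  have hmeas : ∀ n, Measurable (likelihoodRatioProcess Y δ₀ δ₁ n) := fun n => (hL n).comp (hU n)
  have hint : ∀ n, Integrable (likelihoodRatioProcess Y δ₀ δ₁ n) P := fun n => by
    refine (lintegral_ofReal_ne_top_iff_integrable (hmeas n).aestronglyMeasurable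
      (.of_forall (hnonneg n))).1 ?_
    have h := hset n Set.univ MeasurableSet.univ
    rw [preimage_univ, setLIntegral_univ, setLIntegral_univ] at h
    rw [h]
    exact ((lintegral_rnDeriv_invariantVecLaw_le_one hδ hδ₁ n).trans_lt ENNReal.one_lt_top).ne
  refine supermartingale_of_setIntegral_succ_le (fun n => ?_) hint fun n s hs => ?_
  · exact ((hL n).comp (comap_measurable _)).stronglyMeasurable
  · obtain ⟨S, hS, rfl⟩ := hs
    rw [integral_eq_lintegral_of_nonneg_ae (.of_forall (hnonneg _)) (hmeas _).aestronglyMeasurable,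
      integral_eq_lintegral_of_nonneg_ae (.of_forall (hnonneg _)) (hmeas _).aestronglyMeasurable]
    refine ENNReal.toReal_mono ?_ ?_
    · exact ((hint n).lintegral_lt_top.trans_le' (setLIntegral_le_lintegral _ _)).ne
    · rw [hset n S hS]
      refine le_trans (le_of_eq ?_) (setLIntegral_rnDeriv_succ_le hδ hδ₁ hS)
      have hr : Measurable fun (v : Fin (n + 1) → ℝ) (i : Fin n) => v i.castSucc := by fun_prop
      exact hset (n + 1) _ (hS.preimage hr)

end TTest

theorem mainTheorem3 :
    -- the law of the maximal invariants depends on the mean and the scale only through `μ / σ`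
    (∀ (μ : ℝ) (σ : ℝ≥0), 0 < σ →
      (Measure.infinitePi fun _ : ℕ => gaussianReal μ (σ ^ 2)).map TTest.maximalInvariant =
        TTest.invariantLaw (μ / (σ : ℝ))) ∧
    -- the likelihood ratios are genuine densities: the laws are mutually absolutely continuous
    (∀ (δ δ' : ℝ) (n : ℕ), TTest.invariantVecLaw δ n ≪ TTest.invariantVecLaw δ' n) ∧
    -- the likelihood ratio process is a test supermartingale for the one-sided null
    (∀ (Ω : Type*) [MeasurableSpace Ω] (Y : ℕ → Ω → ℝ) (hY : ∀ i, Measurable (Y i))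
      (δ₀ δ₁ : ℝ), δ₀ < δ₁ →
      TTest.IsTestSupermartingale (TTest.likelihoodRatioProcess Y δ₀ δ₁)
        (TTest.invariantFiltration Y hY) (TTest.oneSidedNull Y δ₀)) := by
  refine ⟨fun μ σ hσ => TTest.infinitePi_map_maximalInvariant μ hσ,
    TTest.invariantVecLaw_absolutelyContinuous, fun Ω _ Y hY δ₀ δ₁ hδ => ?_⟩
  exact ⟨fun _ _ => ENNReal.toReal_nonneg, fun _ => TTest.likelihoodRatio_zero δ₀ δ₁ _,
    fun P hP => TTest.supermartingale_likelihoodRatioProcess hY hδ.le hP⟩
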